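/- For an integer $N=2j\ge 1$ let $\mathcal A_N=M_{N+1}(\mathbb C)$ act on $V_j\cong\mathbb C^{N+1}$, with orthonormal basis $|j,m\rangle$ ($m=-j,\dots,j$), and let $\pi_j(J_1),\pi_j(J_2),\pi_j(J_3)$ be the spin-$j$ representation matrices of the standard generators of $\mathfrak{su}(2)$, that is, $J_3|j,m\rangle=m|j,m\rangle$ and $(J_1+iJ_2)|j,m\rangle=\sqrt{(j-m)(j+m+1)}\,|j,m+1\rangle$, $J_1-iJ_2=(J_1+iJ_2)^*$. Let $D_N=1\otimes 1+2\sum_{k=1}^3\pi_j(J_k)\otimes\pi_{1/2}(J_k)$ on $V_j\otimes\mathbb C^2$, let $a\in\mathcal A_N$ act on $V_j\otimes\mathbb C^2$ as $a\otimes 1$, and let $\|[D_N,a]\|$ be the operator norm of the commutator. The spectral distance between states $\omega,\omega'$ of $\mathcal A_N$ is $$d_N(\omega,\omega')=\sup\{|\omega(a)-\omega'(a)| : a=a^*\in\mathcal A_N,\ \|[D_N,a]\|\le 1\}\in[0,\infty].$$ For $\varphi\in\mathbb R$ and $\theta\in[0,\pi]$ the Bloch coherent state is $\psi^N_{(\varphi,\theta)}(a)=\langle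 v,a v\rangle$ with $$v=\sum_{m=-j}^{j}\binom{2j}{j+m}^{1/2}e^{-im\varphi}\,(\sin\tfrac\theta2)^{j+m}(\cos\tfrac\theta2)^{j-m}\,|j,m\rangle ,$$ and the auxiliary distance is $$\rho_N(\theta)=\sup\{|\psi^N_{(0,\theta)}(a)-\psi^N_{(0,0)}(a)| : a=a^*\in\mathcal A_N\text{ diagonal},\ \|[D_N,a]\|\le 1\}.$$ All of these distances, $\rho_N(\theta)$ and $d_N(\psi^N_{(\varphi,\theta)},\psi^N_{(\varphi',\theta')})$, are finite. As $N\to\infty$, $\rho_N(\theta)$ converges to $\theta$ uniformly on $[0,\pi]$. Consequently, $$\lim_{N\to\infty} d_N\bigl(\psi^N_{(\varphi,\theta)},\psi^N_{(\varphi',\theta')}\bigr)=d_{\mathrm{geo}}\bigl((\varphi,\theta),(\varphi',\theta')\bigr),$$ uniformly for pairs of points of $S^2$, where $d_{\mathrm{geo}}$ is the geodesic (great-circle) distance on the round unit sphere, i.e. the angle in $[0,\pi]$ between the unit vectors with spherical coordinates $(\varphi,\theta)$ and $(\varphi',\theta')$, $(\sin\theta\cos\varphi,\sin\theta\sin\varphi,\cos\theta)$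 and $(\sin\theta'\cos\varphi',\sin\theta'\sin\varphi',\cos\theta')$. -/

import Mathlib

open Filter Topology Set Matrix
open scoped Kronecker ENNReal

noncomputable section

namespace FuzzySphere

/-- The algebra `𝒜_N = M_{N+1}(ℂ)` of the fuzzy sphere with label `N = 2j`. The row or column
index `i` stands for the basis vector `|j,m⟩` of `V_j` with `m = i - j`, so `i = j + m`. -/
abbrev Alg (N : ℕ) : Type := Matrix (Fin (N + 1)) (Fin (N + 1)) ℂ

/-- `π_j(H)` for `H = J₃`: the operator `|j,m⟩ ↦ m |j,m⟩`. -/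
def opH (N : ℕ) : Alg N :=
  Matrix.diagonal fun i => (i.val : ℂ) - (N : ℂ) / 2

/-- `π_j(E)` for `E = J₁ + i J₂`: the raising operator
`|j,m⟩ ↦ √((j - m)(j + m + 1)) |j,m+1⟩`. -/
def opE (N : ℕ) : Alg N :=
  Matrix.of fun k i =>
    if k.val = i.val + 1 then
      ((Real.sqrt (((N : ℝ) - (i.val : ℝ)) * ((i.val : ℝ) + 1)) : ℝ) : ℂ)
    else 0

/-- `π_j(F)` for `F = E* = J₁ - i J₂`. -/
def opF (N : ℕ) : Alg N := (opE N)ᴴ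

/-- The generators `π_j(J₁), π_j(J₂), π_j(J₃)` of the spin-`j` representation of `su(2)`,
with `j = N / 2`. -/
def spin (N : ℕ) : Fin 3 → Alg N :=
  ![(1 / 2 : ℂ) • (opE N + opF N), (-Complex.I / 2) • (opE N - opF N), opH N]

/-- The Dirac operator `D_N = (π_j ⊗ π_{1/2})(1 ⊗ 1 + 2 ∑ₖ Jₖ ⊗ Jₖ)` of the irreducible
spectral triple, acting on `V_j ⊗ ℂ²`. -/
def dirac (N : ℕ) : Matrix (Fin (N + 1) × Fin 2) (Fin (N + 1) × Fin 2) ℂ :=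
  1 + (2 : ℂ) • ∑ k : Fin 3, spin N k ⊗ₖ spin 1 k

/-- The commutator `[D_N, a]`, where `a` acts on `V_j ⊗ ℂ²` as `a ⊗ 1`. -/
def diracComm (N : ℕ) (a : Alg N) : Matrix (Fin (N + 1) × Fin 2) (Fin (N + 1) × Fin 2) ℂ :=
  dirac N * (a ⊗ₖ (1 : Matrix (Fin 2) (Fin 2) ℂ))
    - (a ⊗ₖ (1 : Matrix (Fin 2) (Fin 2) ℂ)) * dirac N

/-- The operator norm `‖[D_N, a]‖` on the Hilbert space `V_j ⊗ ℂ²`. -/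
def lipNorm (N : ℕ) (a : Alg N) : ℝ :=
  ‖Matrix.toEuclideanCLM (n := Fin (N + 1) × Fin 2) (𝕜 := ℂ) (diracComm N a)‖

/-- The spectral distance
`d_N(ω, ω') = sup {|ω(a) - ω'(a)| : a = a* ∈ 𝒜_N, ‖[D_N, a]‖ ≤ 1}`, with values in `[0, ∞]`. -/
def spectralDist (N : ℕ) (ω ω' : Alg N → ℂ) : ℝ≥0∞ :=
  ⨆ a ∈ {a : Alg N | a.IsHermitian ∧ lipNorm N a ≤ 1}, ENNReal.ofReal ‖ω a - ω' a‖

/-- The Bloch coherent state vector `|φ,θ)_N`, whose `|j,m⟩`-component is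
`binom(2j, j+m)^{1/2} e^{-imφ} sin(θ/2)^{j+m} cos(θ/2)^{j-m}`. -/
def blochVec (N : ℕ) (φ θ : ℝ) : Fin (N + 1) → ℂ := fun i =>
  ((Real.sqrt (N.choose i.val : ℝ) : ℝ) : ℂ)
    * Complex.exp (-Complex.I * ((i.val : ℂ) - (N : ℂ) / 2) * (φ : ℂ))
    * ((Real.sin (θ / 2) ^ i.val * Real.cos (θ / 2) ^ (N - i.val) : ℝ) : ℂ)

/-- The Bloch coherent state `ψ^N_{(φ,θ)}(a) = (φ,θ| a |φ,θ)_N` on `𝒜_N`. -/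
def blochState (N : ℕ) (φ θ : ℝ) (a : Alg N) : ℂ :=
  star (blochVec N φ θ) ⬝ᵥ (a *ᵥ blochVec N φ θ)

/-- The auxiliary distance `ρ_N(θ)`: the supremum of `|ψ_{(0,θ)}(a) - ψ_{(0,0)}(a)|` over the
self-adjoint diagonal matrices `a` with `‖[D_N, a]‖ ≤ 1`. -/
def auxDist (N : ℕ) (θ : ℝ) : ℝ≥0∞ :=
  ⨆ a ∈ {a : Alg N | a.IsDiag ∧ a.IsHermitian ∧ lipNorm N a ≤ 1},
    ENNReal.ofReal ‖blochState N 0 θ a - blochState N 0 0 a‖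

/-- The point of the unit sphere `S² ⊆ ℝ³` with spherical coordinates `(φ, θ)`: longitude `φ`
and polar angle `θ`. -/
def spherePoint (φ θ : ℝ) : EuclideanSpace ℝ (Fin 3) :=
  !₂[Real.sin θ * Real.cos φ, Real.sin θ * Real.sin φ, Real.cos θ]

/-- The geodesic (great-circle) distance on the round unit sphere between the points with
spherical coordinates `p = (φ, θ)` and `q = (φ', θ')`: the angle in `[0, π]` between the two
unit vectors. -/
def geodesicDist (p q : ℝ × ℝ) : ℝ :=
  InnerProductGeometry.angle (spherePoint p.1 p.2) (spherePoint q.1 q.2)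

/-- The spherical coordinates `(φ, θ)`, with `θ ∈ [0, π]`, of the points of `S²`. -/
def sphereCoords : Set (ℝ × ℝ) := Set.univ ×ˢ Set.Icc 0 Real.pi

end FuzzySphere

end

noncomputable section

namespace FuzzySphere

/-! Upper bound, exact for every `N`: `2 ∑ Jₖ ⊗ Jₖ` is invariant under the diagonal `SU(2)` action,
so `D_N` commutes with simultaneous rotations and `lipNorm` does not increase under conjugation by
rotations. Coherent states are carried to coherent states, and the overlap of two spinors determines
the angle between the points, so one point may be moved to the pole (`exists_rot_to_pole`). Along a
meridian of longitude `φ` the state vector `v` satisfies `v' = X v` with `X = (u E - ū F) / 2`, `u =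
e^{-iφ}`, hence the expectation of `a` has derivative `-⟨v, [X, a] v⟩`. Testing `[D_N, a]` on `v ⊗
χ` for a suitable spinor `χ` bounds this by `lipNorm N a`
(`norm_star_dotProduct_commutator_rotGen_le`). The mean value inequality then bounds both distances
by the angle.

Lower bound, asymptotic: for diagonal `a` the commutator consists of two weighted shifts, so
`lipNorm N a ≤ 1` reduces to a bound on the increments of the entries. The entries `arccos (1 - 2 (i
+ 1) / (N + 2))` satisfy it. Their coherent expectation is a binomial average in `s = sin² (θ/2)`,
uniformly close to the Bernstein approximation of `s ↦ arccos (1 - 2 s)`, whose value at this `s` is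
`θ`. This single matrix serves `ρ_N` directly, and `d_N` after rotation. -/

/-! ### Ladder operators and the `su(2)` relations -/

theorem opE_apply {N : ℕ} (k i : Fin (N + 1)) : opE N k i = if k.val = i.val + 1 then
    ((Real.sqrt (((N : ℝ) - (i.val : ℝ)) * ((i.val : ℝ) + 1)) : ℝ) : ℂ) else 0 := rfl

theorem opF_apply {N : ℕ} (i k : Fin (N + 1)) : opF N i k = if k.val = i.val + 1 then
    ((Real.sqrt (((N : ℝ) - (i.val : ℝ)) * ((i.val : ℝ) + 1)) : ℝ) : ℂ) else 0 := by
  rw [opF, Matrix.conjTranspose_apply, opE_apply]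
  split_ifs
  · exact Complex.conj_ofReal _
  · exact star_zero _

theorem opE_mulVec_zero {N : ℕ} (v : Fin (N + 1) → ℂ) : (opE N *ᵥ v) 0 = 0 := by
  simp [Matrix.mulVec, dotProduct, opE_apply]

theorem opE_mulVec_succ {N : ℕ} (v : Fin (N + 1) → ℂ) (i : Fin N) : (opE N *ᵥ v) i.succ =
    ((Real.sqrt (((N : ℝ) - (i.val : ℝ)) * ((i.val : ℝ) + 1)) : ℝ) : ℂ) * v i.castSucc := by
  rw [Matrix.mulVec, dotProduct, Finset.sum_eq_single i.castSucc]
  · simp [opE_apply]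
  · intro k _ hk
    rw [opE_apply, if_neg, zero_mul]
    intro h
    apply hk
    ext
    simp at h ⊢
    omega
  · simp

theorem opF_mulVec_last {N : ℕ} (v : Fin (N + 1) → ℂ) : (opF N *ᵥ v) (Fin.last N) = 0 := by
  rw [Matrix.mulVec, dotProduct]
  refine Finset.sum_eq_zero fun k _ => ?_
  rw [opF_apply, if_neg, zero_mul]
  have := k.is_lt
  simp
  omega

theorem opF_mulVec_castSucc {N : ℕ} (v : Fin (N + 1) → ℂ) (i : Fin N) :
    (opF N *ᵥ v) i.castSucc =
    ((Real.sqrt (((N : ℝ) - (i.val : ℝ)) * ((i.val : ℝ) + 1)) : ℝ) : ℂ) * v i.succ := by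
  rw [Matrix.mulVec, dotProduct, Finset.sum_eq_single i.succ]
  · simp [opF_apply]
  · intro k _ hk
    rw [opF_apply, if_neg, zero_mul]
    intro h
    apply hk
    ext
    simpa using h
  · simp

theorem sqrt_weight_mul_self {N : ℕ} (i : Fin N) :
    ((Real.sqrt (((N : ℝ) - (i.val : ℝ)) * ((i.val : ℝ) + 1)) : ℝ) : ℂ)
      * ((Real.sqrt (((N : ℝ) - (i.val : ℝ)) * ((i.val : ℝ) + 1)) : ℝ) : ℂ)
      = ((N : ℂ) - i.val) * (i.val + 1) := by
  have h : (i.val : ℝ) ≤ N := by exact_mod_cast i.is_lt.le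
  rw [← Complex.ofReal_mul, Real.mul_self_sqrt (mul_nonneg (sub_nonneg.2 h) (by positivity))]
  push_cast
  ring

theorem opE_opF_mulVec {N : ℕ} (v : Fin (N + 1) → ℂ) (i : Fin (N + 1)) :
    (opE N *ᵥ (opF N *ᵥ v)) i = ((N : ℂ) - i.val + 1) * i.val * v i := by
  induction i using Fin.cases with
  | zero => simp [opE_mulVec_zero]
  | succ i =>
    rw [opE_mulVec_succ, opF_mulVec_castSucc, ← mul_assoc, sqrt_weight_mul_self]
    push_cast [Fin.val_succ]
    ring

theorem opF_opE_mulVec {N : ℕ} (v : Fin (N + 1) → ℂ) (i : Fin (N + 1)) :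
    (opF N *ᵥ (opE N *ᵥ v)) i = ((N : ℂ) - i.val) * (i.val + 1) * v i := by
  induction i using Fin.lastCases with
  | last => simp [opF_mulVec_last]
  | cast i =>
    rw [opF_mulVec_castSucc, opE_mulVec_succ, ← mul_assoc, sqrt_weight_mul_self]
    simp

theorem opE_mul_opF_sub (N : ℕ) : opE N * opF N - opF N * opE N = (2 : ℂ) • opH N := by
  refine Matrix.ext_of_mulVec_single fun j => ?_
  ext i
  rw [Matrix.sub_mulVec, Pi.sub_apply, ← Matrix.mulVec_mulVec, ← Matrix.mulVec_mulVec,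
    opE_opF_mulVec, opF_opE_mulVec, Matrix.smul_mulVec, Pi.smul_apply, opH, Matrix.mulVec_diagonal,
    smul_eq_mul]
  ring

theorem opE_mul_opH_sub (N : ℕ) : opE N * opH N - opH N * opE N = - opE N := by
  ext k i
  simp only [opE, opH, Matrix.sub_apply, Matrix.mul_diagonal, Matrix.diagonal_mul, Matrix.of_apply,
    Matrix.neg_apply]
  split_ifs with h
  · rw [h]; push_cast; ring
  · simp

theorem opF_mul_opH_sub (N : ℕ) : opF N * opH N - opH N * opF N = opF N := by
  have h := congrArg Matrix.conjTranspose (opE_mul_opH_sub N)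
  have hH : (opH N)ᴴ = opH N := by
    simp only [opH, Matrix.diagonal_conjTranspose]
    congr 1; ext i; simp
  simp only [Matrix.conjTranspose_sub, Matrix.conjTranspose_mul, hH, Matrix.conjTranspose_neg] at h
  rw [opF, ← neg_sub, h, neg_neg]

/-! ### The Dirac operator and its rotational invariance -/

theorem dirac_eq (N : ℕ) : dirac N =
    1 + ((2 : ℂ) • (opH N ⊗ₖ opH 1) + opE N ⊗ₖ opF 1 + opF N ⊗ₖ opE 1) := by
  have hI : Complex.I * Complex.I = -1 := Complex.I_mul_I
  have h (n : ℕ) : spin n 0 = (1 / 2 : ℂ) • (opE n + opF n) ∧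
      spin n 1 = (-Complex.I / 2) • (opE n - opF n) ∧ spin n 2 = opH n := ⟨rfl, rfl, rfl⟩
  rw [dirac]
  congr 1
  ext ⟨a, b⟩ ⟨c, d⟩
  simp only [Fin.sum_univ_three, h, Matrix.smul_apply, Matrix.add_apply,
    Matrix.kroneckerMap_apply, Matrix.sub_apply, smul_eq_mul]
  linear_combination (1/2) * (opE N a c - opF N a c) * (opE 1 b d - opF 1 b d) * hI

/-- The generator `(u E - ū F) / 2` of the rotations about a horizontal axis. -/
def rotGen (N : ℕ) (u : ℂ) : Alg N := (1 / 2 : ℂ) • (u • opE N - star u • opF N)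

theorem rotGen_conjTranspose (N : ℕ) (u : ℂ) : (rotGen N u)ᴴ = - rotGen N u := by
  have hF : (opF N)ᴴ = opE N := Matrix.conjTranspose_conjTranspose _
  have h2 : star (1 / 2 : ℂ) = 1 / 2 := by simp
  rw [rotGen, Matrix.conjTranspose_smul, Matrix.conjTranspose_sub, Matrix.conjTranspose_smul,
    Matrix.conjTranspose_smul, hF, ← opF, star_star, h2, ← smul_neg, neg_sub]

/-- The identity summand of `D_N` is central. What remains is a sum of elementary tensors, so the
hypothesis can be expanded with the mixed product rule. -/
theorem commute_kronecker_dirac {N : ℕ} {A : Alg N} {B : Alg 1}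
    (h : A ⊗ₖ (1 : Alg 1) * (dirac N - 1) - (dirac N - 1) * A ⊗ₖ (1 : Alg 1)
      + ((1 : Alg N) ⊗ₖ B * (dirac N - 1) - (dirac N - 1) * (1 : Alg N) ⊗ₖ B) = 0) :
    Commute (dirac N) (A ⊗ₖ (1 : Alg 1) + (1 : Alg N) ⊗ₖ B) := by
  rw [commute_iff_eq, ← sub_eq_zero, ← neg_eq_zero, ← h]
  noncomm_ring

theorem dirac_commute_opE (N : ℕ) :
    Commute (dirac N) (opE N ⊗ₖ (1 : Alg 1) + (1 : Alg N) ⊗ₖ opE 1) := by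
  apply commute_kronecker_dirac
  have h1 := fun n => sub_eq_iff_eq_add.1 (opE_mul_opH_sub n)
  have h2 := fun n => sub_eq_iff_eq_add.1 (opE_mul_opF_sub n)
  rw [dirac_eq, add_sub_cancel_left]
  simp only [mul_add, add_mul, Matrix.mul_smul, Matrix.smul_mul, ← Matrix.mul_kronecker_mul,
    one_mul, mul_one, h1, h2]
  ext ⟨a, b⟩ ⟨c, d⟩
  simp only [Matrix.smul_apply, Matrix.add_apply, Matrix.neg_apply, Matrix.zero_apply,
    Matrix.kroneckerMap_apply, Matrix.sub_apply, smul_eq_mul]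
  ring

theorem dirac_commute_opF (N : ℕ) :
    Commute (dirac N) (opF N ⊗ₖ (1 : Alg 1) + (1 : Alg N) ⊗ₖ opF 1) := by
  apply commute_kronecker_dirac
  have h1 := fun n => sub_eq_iff_eq_add.1 (opF_mul_opH_sub n)
  have h2 := fun n => sub_eq_iff_eq_add.1 (opE_mul_opF_sub n)
  rw [dirac_eq, add_sub_cancel_left]
  simp only [mul_add, add_mul, Matrix.mul_smul, Matrix.smul_mul, ← Matrix.mul_kronecker_mul,
    one_mul, mul_one, h1, h2]
  ext ⟨a, b⟩ ⟨c, d⟩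
  simp only [Matrix.smul_apply, Matrix.add_apply, Matrix.zero_apply,
    Matrix.kroneckerMap_apply, Matrix.sub_apply, smul_eq_mul]
  ring

theorem dirac_commute_rotGen (N : ℕ) (u : ℂ) :
    Commute (dirac N) (rotGen N u ⊗ₖ (1 : Alg 1) + (1 : Alg N) ⊗ₖ rotGen 1 u) := by
  have h : rotGen N u ⊗ₖ (1 : Alg 1) + (1 : Alg N) ⊗ₖ rotGen 1 u =
      (u / 2) • (opE N ⊗ₖ (1 : Alg 1) + (1 : Alg N) ⊗ₖ opE 1)
        - (star u / 2) • (opF N ⊗ₖ (1 : Alg 1) + (1 : Alg N) ⊗ₖ opF 1) := by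
    ext ⟨a, b⟩ ⟨c, d⟩
    simp only [rotGen, Matrix.smul_apply, Matrix.add_apply, Matrix.kroneckerMap_apply,
      Matrix.sub_apply, smul_eq_mul]
    ring
  rw [h]
  exact ((dirac_commute_opE N).smul_right _).sub_right ((dirac_commute_opF N).smul_right _)

theorem diracComm_eq (N : ℕ) (a : Alg N) : diracComm N a =
    (2 : ℂ) • ((opH N * a - a * opH N) ⊗ₖ opH 1) + (opE N * a - a * opE N) ⊗ₖ opF 1
      + (opF N * a - a * opF N) ⊗ₖ opE 1 := by
  have h : diracComm N a = dirac N * (a ⊗ₖ (1 : Alg 1)) - (a ⊗ₖ (1 : Alg 1)) * dirac N := rfl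
  rw [h, dirac_eq]
  simp only [mul_add, add_mul, Matrix.mul_smul, Matrix.smul_mul, ← Matrix.mul_kronecker_mul,
    one_mul, mul_one]
  ext ⟨a, b⟩ ⟨c, d⟩
  simp only [Matrix.smul_apply, Matrix.add_apply,
    Matrix.kroneckerMap_apply, Matrix.sub_apply, smul_eq_mul]
  ring

/-! ### Coherent vectors as symmetric powers of spinors -/

/-- The coherent vector of the spinor `z`, the `N`-th symmetric power of `z`. -/
def cohVec (N : ℕ) (z : Fin 2 → ℂ) : Fin (N + 1) → ℂ := fun i =>
  ((Real.sqrt (N.choose i.val : ℝ) : ℝ) : ℂ) * (z 1 ^ i.val * z 0 ^ (N - i.val))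

theorem sqrt_choose_mul_weight {N m : ℕ} (h : m < N) :
    ((Real.sqrt (((N : ℝ) - m) * ((m : ℝ) + 1)) : ℝ) : ℂ) * ((Real.sqrt (N.choose m : ℝ) : ℝ) : ℂ)
      = (m + 1) * ((Real.sqrt (N.choose (m + 1) : ℝ) : ℝ) : ℂ) := by
  have hN : (0 : ℝ) ≤ (N : ℝ) - m := sub_nonneg.2 (by exact_mod_cast h.le)
  have hc : (N.choose (m + 1) : ℝ) * (m + 1) = N.choose m * (N - m) := by
    have := Nat.choose_succ_right_eq N m
    rw [← Nat.cast_sub h.le]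
    exact_mod_cast this
  have : ((N : ℝ) - m) * ((m : ℝ) + 1) * N.choose m = ((m : ℝ) + 1) ^ 2 * N.choose (m + 1) := by
    linear_combination (-(m : ℝ) - 1) * hc
  have hm : (0 : ℝ) ≤ (m : ℝ) + 1 := by positivity
  rw [← Complex.ofReal_mul, ← Real.sqrt_mul (by positivity), this, Real.sqrt_mul (by positivity),
    Real.sqrt_sq hm]
  push_cast
  rfl

theorem sqrt_choose_succ_mul_weight {N m : ℕ} (h : m < N) :
    ((Real.sqrt (((N : ℝ) - m) * ((m : ℝ) + 1)) : ℝ) : ℂ)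
        * ((Real.sqrt (N.choose (m + 1) : ℝ) : ℝ) : ℂ)
      = ((N : ℂ) - m) * ((Real.sqrt (N.choose m : ℝ) : ℝ) : ℂ) := by
  have hN : (0 : ℝ) ≤ (N : ℝ) - m := sub_nonneg.2 (by exact_mod_cast h.le)
  have hc : (N.choose (m + 1) : ℝ) * (m + 1) = N.choose m * (N - m) := by
    have := Nat.choose_succ_right_eq N m
    rw [← Nat.cast_sub h.le]
    exact_mod_cast this
  have : ((N : ℝ) - m) * ((m : ℝ) + 1) * N.choose (m + 1) = ((N : ℝ) - m) ^ 2 * N.choose m := by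
    linear_combination ((N : ℝ) - m) * hc
  rw [← Complex.ofReal_mul, ← Real.sqrt_mul (by positivity), this, Real.sqrt_mul (by positivity),
    Real.sqrt_sq hN]
  push_cast
  rfl

theorem opE_mulVec_cohVec (N : ℕ) (z : Fin 2 → ℂ) (i : Fin (N + 1)) : (opE N *ᵥ cohVec N z) i =
    ((Real.sqrt (N.choose i.val : ℝ) : ℝ) : ℂ)
      * (i.val * z 1 ^ (i.val - 1) * z 0 * z 0 ^ (N - i.val)) := by
  induction i using Fin.cases with
  | zero => simp [opE_mulVec_zero]
  | succ m =>
    have h := m.is_lt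
    rw [opE_mulVec_succ, cohVec, ← mul_assoc, Fin.val_castSucc, sqrt_choose_mul_weight h,
      Fin.val_succ, Nat.add_sub_cancel, show N - m.val = N - (m.val + 1) + 1 by omega]
    push_cast
    ring

theorem opF_mulVec_cohVec (N : ℕ) (z : Fin 2 → ℂ) (i : Fin (N + 1)) : (opF N *ᵥ cohVec N z) i =
    ((Real.sqrt (N.choose i.val : ℝ) : ℝ) : ℂ)
      * (z 1 ^ i.val * z 1 * ((N - i.val : ℕ) * z 0 ^ (N - i.val - 1))) := by
  induction i using Fin.lastCases with
  | last => simp [opF_mulVec_last]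
  | cast m =>
    have h := m.is_lt
    rw [opF_mulVec_castSucc, cohVec, ← mul_assoc, Fin.val_castSucc, Fin.val_succ,
      sqrt_choose_succ_mul_weight h, Nat.cast_sub h.le, show N - (m.val + 1) = N - m.val - 1 by omega]
    ring

theorem cohVec_one (z : Fin 2 → ℂ) : cohVec 1 z = z := by
  ext i
  fin_cases i <;> simp [cohVec]

theorem rotGen_one_mulVec (u : ℂ) (z : Fin 2 → ℂ) :
    rotGen 1 u *ᵥ z = ![-(star u * z 1) / 2, u * z 0 / 2] := by
  have hE := opE_mulVec_cohVec 1 z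
  have hF := opF_mulVec_cohVec 1 z
  rw [cohVec_one] at hE hF
  ext i
  rw [rotGen, Matrix.smul_mulVec, Matrix.sub_mulVec, Matrix.smul_mulVec, Matrix.smul_mulVec]
  simp only [Pi.smul_apply, Pi.sub_apply]
  erw [hE i, hF i]
  fin_cases i
  · simp; ring
  · simp; ring

/-- The infinitesimal form of the equivariance of the symmetric power: by the product rule `z₁ⁱ
z₀^(N-i)` differentiates into the two terms produced by `E` and `F`. -/
theorem hasDerivAt_cohVec {u : ℂ} {γ : ℂ → Fin 2 → ℂ} {t : ℂ}
    (h : HasDerivAt γ (rotGen 1 u *ᵥ γ t) t) (N : ℕ) :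
    HasDerivAt (fun s => cohVec N (γ s)) (rotGen N u *ᵥ cohVec N (γ t)) t := by
  rw [rotGen_one_mulVec] at h
  rw [hasDerivAt_pi] at h ⊢
  intro i
  have h0 := (h 0).pow (N - i.val)
  have h1 := (h 1).pow i.val
  have h2 := (h1.mul h0).const_mul ((Real.sqrt (N.choose i.val : ℝ) : ℝ) : ℂ)
  refine h2.congr_deriv ?_
  rw [rotGen, Matrix.smul_mulVec, Matrix.sub_mulVec, Matrix.smul_mulVec, Matrix.smul_mulVec]
  simp only [Pi.smul_apply, Pi.sub_apply, opE_mulVec_cohVec, opF_mulVec_cohVec, smul_eq_mul,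
    Matrix.cons_val_zero, Matrix.cons_val_one, Pi.pow_apply]
  ring

theorem blochVec_eq_cohVec (N : ℕ) (φ θ : ℝ) : blochVec N φ θ = cohVec N (blochVec 1 φ θ) := by
  ext i
  have h : i.val ≤ N := Nat.lt_succ_iff.1 i.is_lt
  -- With `m = i - N/2`, the phase `e^{-imφ}` splits into `i` factors `e^{-iφ/2}` and `N - i`
  -- factors `e^{iφ/2}`, the phases of the two spinor components.
  have hexp : Complex.exp (-Complex.I * ((i.val : ℂ) - (N : ℂ) / 2) * (φ : ℂ)) =
      Complex.exp (-Complex.I * (1 - 1 / 2) * (φ : ℂ)) ^ i.val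
        * Complex.exp (-Complex.I * (0 - 1 / 2) * (φ : ℂ)) ^ (N - i.val) := by
    rw [← Complex.exp_nat_mul, ← Complex.exp_nat_mul, ← Complex.exp_add, Nat.cast_sub h]
    congr 1
    ring
  simp only [blochVec, cohVec, hexp]
  simp
  ring

theorem cohVec_smul (N : ℕ) (c : ℂ) (z : Fin 2 → ℂ) : cohVec N (c • z) = c ^ N • cohVec N z := by
  ext i
  have h : i.val ≤ N := Nat.lt_succ_iff.1 i.is_lt
  simp only [cohVec, Pi.smul_apply, smul_eq_mul, mul_pow]
  have hp : c ^ N = c ^ i.val * c ^ (N - i.val) := by rw [← pow_add, Nat.add_sub_cancel' h]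
  rw [hp]
  ring

theorem star_cohVec_dotProduct (N : ℕ) (x y : Fin 2 → ℂ) :
    star (cohVec N x) ⬝ᵥ cohVec N y = (star x ⬝ᵥ y) ^ N := by
  have h : star x ⬝ᵥ y = star (x 1) * y 1 + star (x 0) * y 0 := by
    simp [dotProduct, Fin.sum_univ_two, add_comm]
  rw [h, add_pow, Finset.sum_range, dotProduct]
  refine Finset.sum_congr rfl fun i _ => ?_
  have hs : ((Real.sqrt (N.choose i.val : ℝ) : ℝ) : ℂ) * ((Real.sqrt (N.choose i.val : ℝ) : ℝ) : ℂ)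
      = N.choose i.val := by
    rw [← Complex.ofReal_mul, Real.mul_self_sqrt (Nat.cast_nonneg _)]
    simp
  simp only [cohVec, Pi.star_apply, star_mul', mul_pow, ← hs, star_pow, Complex.star_def, Complex.conj_ofReal]
  ring

/-- The coherent state of the spinor `z`. -/
def cohState (N : ℕ) (z : Fin 2 → ℂ) (a : Alg N) : ℂ :=
  star (cohVec N z) ⬝ᵥ (a *ᵥ cohVec N z)

theorem blochState_eq_cohState (N : ℕ) (φ θ : ℝ) :
    blochState N φ θ = cohState N (blochVec 1 φ θ) := by
  funext a
  rw [blochState, cohState, blochVec_eq_cohVec]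

theorem cohState_smul (N : ℕ) {c : ℂ} (hc : ‖c‖ = 1) (z : Fin 2 → ℂ) :
    cohState N (c • z) = cohState N z := by
  funext a
  have h : star (c ^ N) * c ^ N = 1 := by
    rw [Complex.star_def, Complex.conj_mul', norm_pow, hc]
    simp
  rw [cohState, cohVec_smul, star_smul, smul_dotProduct, Matrix.mulVec_smul, dotProduct_smul,
    smul_smul, h, one_smul, cohState]

/-! ### Finite rotations and invariance of the Lipschitz norm -/

section Rotation

open scoped Matrix.Norms.L2Operator

theorem exp_neg_mul_exp {n : Type*} [Fintype n] [DecidableEq n] (A : Matrix n n ℂ) :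
    NormedSpace.exp (-A) * NormedSpace.exp A = 1 := by
  rw [← Matrix.exp_add_of_commute _ _ (Commute.refl A).neg_left, neg_add_cancel,
    NormedSpace.exp_zero]

theorem hasDerivAt_mulVec {n : Type*} [Fintype n] [DecidableEq n] {A : ℂ → Matrix n n ℂ}
    {A' : Matrix n n ℂ} {v : ℂ → n → ℂ} {v' : n → ℂ} {t : ℂ} (hA : HasDerivAt A A' t)
    (hv : HasDerivAt v v' t) :
    HasDerivAt (fun s => A s *ᵥ v s) (A' *ᵥ v t + A t *ᵥ v') t := by
  rw [hasDerivAt_pi] at hv ⊢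
  intro i
  have hij : ∀ j, HasDerivAt (fun s => A s i j) (A' i j) t := fun j =>
    (Matrix.entryLinearMap ℂ ℂ i j).toContinuousLinearMap.hasFDerivAt.comp_hasDerivAt t hA
  have := HasDerivAt.fun_sum (u := Finset.univ) fun j _ => (hij j).mul (hv j)
  simpa [Matrix.mulVec, dotProduct, Finset.sum_add_distrib] using this

/-- Uniqueness for the linear equation `v' = X v`: the derivative of `exp (-sX) v(s)` vanishes. -/
theorem eq_exp_smul_mulVec {n : Type*} [Fintype n] [DecidableEq n] {X : Matrix n n ℂ}
    {v : ℂ → n → ℂ} (hv : ∀ t, HasDerivAt v (X *ᵥ v t) t) (t : ℂ) :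
    v t = NormedSpace.exp (t • X) *ᵥ v 0 := by
  have hd : ∀ s, HasDerivAt (fun s => NormedSpace.exp (s • (-X)) *ᵥ v s) 0 s := by
    intro s
    have h := hasDerivAt_mulVec (hasDerivAt_exp_smul_const (-X) s) (hv s)
    refine h.congr_deriv ?_
    rw [mul_neg, Matrix.neg_mulVec, ← Matrix.mulVec_mulVec, neg_add_cancel]
  have h0 := is_const_of_deriv_eq_zero (fun s => (hd s).differentiableAt) (fun s => (hd s).deriv) t 0
  simp only [zero_smul, NormedSpace.exp_zero, Matrix.one_mulVec] at h0
  rw [← h0, Matrix.mulVec_mulVec]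
  have := exp_neg_mul_exp (-(t • X))
  rw [neg_neg] at this
  rw [smul_neg, this, Matrix.one_mulVec]

/-- The rotation by the angle `t` generated by `rotGen N u`. -/
def rot (N : ℕ) (u : ℂ) (t : ℝ) : Alg N := NormedSpace.exp ((t : ℂ) • rotGen N u)

/-- Both sides solve the same linear equation with the same initial value, by `hasDerivAt_cohVec`.
-/
theorem rot_mulVec_cohVec (N : ℕ) (u : ℂ) (t : ℝ) (z : Fin 2 → ℂ) :
    rot N u t *ᵥ cohVec N z = cohVec N (rot 1 u t *ᵥ z) := by
  have h : ∀ s : ℂ, HasDerivAt (fun s : ℂ => NormedSpace.exp (s • rotGen 1 u) *ᵥ z)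
      (rotGen 1 u *ᵥ (NormedSpace.exp (s • rotGen 1 u) *ᵥ z)) s := by
    intro s
    have := hasDerivAt_mulVec (hasDerivAt_exp_smul_const' (rotGen 1 u) s) (hasDerivAt_const s z)
    refine this.congr_deriv ?_
    rw [Matrix.mulVec_zero, add_zero, Matrix.mulVec_mulVec]
  have := eq_exp_smul_mulVec (fun s => hasDerivAt_cohVec (h s) N) t
  rw [zero_smul, NormedSpace.exp_zero, Matrix.one_mulVec] at this
  exact this.symm

theorem rot_conjTranspose (N : ℕ) (u : ℂ) (t : ℝ) : (rot N u t)ᴴ = rot N u (-t) := by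
  have h : star (t : ℂ) = t := Complex.conj_ofReal t
  rw [rot, ← Matrix.exp_conjTranspose, Matrix.conjTranspose_smul, rotGen_conjTranspose, h, smul_neg,
    ← neg_smul, rot, Complex.ofReal_neg]

theorem rot_neg_mul_rot (N : ℕ) (u : ℂ) (t : ℝ) : rot N u (-t) * rot N u t = 1 := by
  rw [rot, rot, Complex.ofReal_neg, neg_smul, exp_neg_mul_exp]

theorem rot_mul_rot_neg (N : ℕ) (u : ℂ) (t : ℝ) : rot N u t * rot N u (-t) = 1 := by
  have := rot_neg_mul_rot N u (-t)
  rwa [neg_neg] at this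

theorem exp_kronecker_one {m n : Type*} [Fintype m] [DecidableEq m] [Fintype n] [DecidableEq n]
    (A : Matrix m m ℂ) :
    NormedSpace.exp (A ⊗ₖ (1 : Matrix n n ℂ)) = NormedSpace.exp A ⊗ₖ (1 : Matrix n n ℂ) := by
  let _ : NormedAlgebra ℚ (Matrix m m ℂ) := NormedAlgebra.restrictScalars ℚ ℂ _
  let f : Matrix m m ℂ →+* Matrix (m × n) (m × n) ℂ :=
    { toFun := fun A => A ⊗ₖ (1 : Matrix n n ℂ)
      map_one' := Matrix.one_kronecker_one
      map_mul' := fun A B => by rw [← Matrix.mul_kronecker_mul, one_mul]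
      map_zero' := Matrix.zero_kronecker _
      map_add' := fun A B => Matrix.add_kronecker _ _ _ }
  have hf : Continuous f := by
    refine continuous_matrix fun i j => ?_
    exact (continuous_id.matrix_elem _ _).mul continuous_const
  exact (NormedSpace.map_exp f hf A).symm

theorem exp_one_kronecker {m n : Type*} [Fintype m] [DecidableEq m] [Fintype n] [DecidableEq n]
    (A : Matrix m m ℂ) :
    NormedSpace.exp ((1 : Matrix n n ℂ) ⊗ₖ A) = (1 : Matrix n n ℂ) ⊗ₖ NormedSpace.exp A := by
  let _ : NormedAlgebra ℚ (Matrix m m ℂ) := NormedAlgebra.restrictScalars ℚ ℂ _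
  let f : Matrix m m ℂ →+* Matrix (n × m) (n × m) ℂ :=
    { toFun := fun A => (1 : Matrix n n ℂ) ⊗ₖ A
      map_one' := Matrix.one_kronecker_one
      map_mul' := fun A B => by rw [← Matrix.mul_kronecker_mul, one_mul]
      map_zero' := Matrix.kronecker_zero _
      map_add' := fun A B => Matrix.kronecker_add _ _ _ }
  have hf : Continuous f := by
    refine continuous_matrix fun i j => ?_
    exact continuous_const.mul (continuous_id.matrix_elem _ _)
  exact (NormedSpace.map_exp f hf A).symm

/-- The two summands of the total generator commute, so its exponential factors as a tensor product
of rotations. -/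
theorem dirac_commute_rot (N : ℕ) (u : ℂ) (t : ℝ) :
    Commute (dirac N) (rot N u t ⊗ₖ rot 1 u t) := by
  have h : rot N u t ⊗ₖ rot 1 u t =
      NormedSpace.exp ((t : ℂ) • (rotGen N u ⊗ₖ (1 : Alg 1) + (1 : Alg N) ⊗ₖ rotGen 1 u)) := by
    rw [smul_add, ← Matrix.smul_kronecker, ← Matrix.kronecker_smul, Matrix.exp_add_of_commute,
      exp_kronecker_one, exp_one_kronecker, ← Matrix.mul_kronecker_mul, one_mul, mul_one, rot, rot]
    rw [commute_iff_eq, ← Matrix.mul_kronecker_mul, ← Matrix.mul_kronecker_mul, one_mul, mul_one,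
      one_mul, mul_one]
  rw [h]
  exact ((dirac_commute_rotGen N u).smul_right _).exp_right

/-- On `a ⊗ 1` the spinor rotation cancels, so conjugating `a` amounts to conjugating `a ⊗ 1` by a
unitary that commutes with `D_N`. -/
theorem diracComm_rot_conj (N : ℕ) (u : ℂ) (t : ℝ) (a : Alg N) :
    diracComm N (rot N u t * a * rot N u (-t)) =
      (rot N u t ⊗ₖ rot 1 u t) * diracComm N a * (rot N u t ⊗ₖ rot 1 u t)ᴴ := by
  have h (b : Alg N) : diracComm N b = dirac N * (b ⊗ₖ (1 : Alg 1)) - (b ⊗ₖ (1 : Alg 1)) * dirac N :=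
    rfl
  have hW : (rot N u t ⊗ₖ rot 1 u t)ᴴ = rot N u (-t) ⊗ₖ rot 1 u (-t) := by
    rw [Matrix.conjTranspose_kronecker, rot_conjTranspose, rot_conjTranspose]
  have hk : (rot N u t * a * rot N u (-t)) ⊗ₖ (1 : Alg 1) =
      (rot N u t ⊗ₖ rot 1 u t) * (a ⊗ₖ (1 : Alg 1)) * (rot N u (-t) ⊗ₖ rot 1 u (-t)) := by
    rw [← Matrix.mul_kronecker_mul, ← Matrix.mul_kronecker_mul, mul_one, rot_mul_rot_neg]
  have h1 := dirac_commute_rot N u t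
  have h2 := dirac_commute_rot N u (-t)
  rw [hW, h, h, hk, mul_sub, sub_mul]
  congr 1
  · simp only [← mul_assoc]
    rw [h1.eq]
  · simp only [mul_assoc]
    rw [← h2.eq]

theorem lipNorm_eq_norm (N : ℕ) (a : Alg N) : lipNorm N a = ‖diracComm N a‖ := rfl

theorem lipNorm_rot_conj_le (N : ℕ) (u : ℂ) (t : ℝ) (a : Alg N) :
    lipNorm N (rot N u t * a * rot N u (-t)) ≤ lipNorm N a := by
  rw [lipNorm_eq_norm, lipNorm_eq_norm, diracComm_rot_conj]
  have hU : (rot N u t ⊗ₖ rot 1 u t) ∈ unitary (Matrix (Fin (N + 1) × Fin 2) (Fin (N + 1) × Fin 2) ℂ) := by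
    rw [Unitary.mem_iff, Matrix.star_eq_conjTranspose, Matrix.conjTranspose_kronecker,
      rot_conjTranspose, rot_conjTranspose, ← Matrix.mul_kronecker_mul, ← Matrix.mul_kronecker_mul,
      rot_neg_mul_rot, rot_neg_mul_rot, rot_mul_rot_neg, rot_mul_rot_neg]
    exact ⟨Matrix.one_kronecker_one, Matrix.one_kronecker_one⟩
  rw [← Matrix.star_eq_conjTranspose]
  have h1 := CStarRing.norm_of_mem_unitary hU
  have h2 := CStarRing.norm_of_mem_unitary (Unitary.star_mem hU)
  refine (norm_mul_le _ _).trans ?_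
  rw [h2, mul_one]
  refine (norm_mul_le _ _).trans ?_
  rw [h1, one_mul]

end Rotation

/-! ### Coherent states under rotation; moving a pair of points to the pole -/

theorem star_mulVec_dotProduct_mulVec {n : Type*} [Fintype n] (M A : Matrix n n ℂ) (x y : n → ℂ) :
    star (M *ᵥ x) ⬝ᵥ (A *ᵥ y) = star x ⬝ᵥ ((Mᴴ * A) *ᵥ y) := by
  rw [Matrix.star_mulVec, ← Matrix.dotProduct_mulVec, Matrix.mulVec_mulVec]

theorem star_rot_mulVec_dotProduct (N : ℕ) (u : ℂ) (t : ℝ) (x y : Fin (N + 1) → ℂ) :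
    star (rot N u t *ᵥ x) ⬝ᵥ (rot N u t *ᵥ y) = star x ⬝ᵥ y := by
  rw [star_mulVec_dotProduct_mulVec, rot_conjTranspose, rot_neg_mul_rot, Matrix.one_mulVec]

theorem cohState_rot_mulVec (N : ℕ) (u : ℂ) (t : ℝ) (z : Fin 2 → ℂ) (a : Alg N) :
    cohState N (rot 1 u t *ᵥ z) a = cohState N z (rot N u (-t) * a * rot N u t) := by
  rw [cohState, ← rot_mulVec_cohVec, Matrix.mulVec_mulVec, star_mulVec_dotProduct_mulVec,
    rot_conjTranspose, ← mul_assoc, cohState]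

/-- The meridian of longitude `φ` in spinor coordinates, with complexified polar angle. -/
def meridian (φ : ℝ) (s : ℂ) : Fin 2 → ℂ :=
  ![Complex.exp (Complex.I * φ / 2) * Complex.cos (s / 2),
    Complex.exp (-Complex.I * φ / 2) * Complex.sin (s / 2)]

theorem meridian_ofReal (φ θ : ℝ) : meridian φ θ = blochVec 1 φ θ := by
  ext i
  fin_cases i
  · simp [meridian, blochVec]
    left
    congr 1
    ring
  · simp [meridian, blochVec]
    left
    congr 1
    ring

theorem hasDerivAt_meridian (φ : ℝ) (s : ℂ) : HasDerivAt (meridian φ)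
    (rotGen 1 (Complex.exp (-Complex.I * φ)) *ᵥ meridian φ s) s := by
  have hs : HasDerivAt (fun s : ℂ => s / 2) (1 / 2) s := (hasDerivAt_id s).div_const 2
  have hstar : star (Complex.exp (-Complex.I * φ)) = Complex.exp (Complex.I * φ) := by
    rw [Complex.star_def, ← Complex.exp_conj]
    simp
  have e1 : Complex.exp (Complex.I * φ) * Complex.exp (-Complex.I * φ / 2)
      = Complex.exp (Complex.I * φ / 2) := by
    rw [← Complex.exp_add]
    congr 1
    ring
  have e2 : Complex.exp (-Complex.I * φ) * Complex.exp (Complex.I * φ / 2)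
      = Complex.exp (-Complex.I * φ / 2) := by
    rw [← Complex.exp_add]
    congr 1
    ring
  rw [rotGen_one_mulVec, hasDerivAt_pi, hstar]
  intro i
  fin_cases i
  · have := hs.ccos.const_mul (Complex.exp (Complex.I * φ / 2))
    simp only [meridian, Fin.zero_eta, Matrix.cons_val_zero, Matrix.cons_val_one]
    refine this.congr_deriv ?_
    rw [← e1]
    ring
  · have := hs.csin.const_mul (Complex.exp (-Complex.I * φ / 2))
    simp only [meridian, Fin.mk_one, Matrix.cons_val_zero, Matrix.cons_val_one]
    refine this.congr_deriv ?_
    rw [← e2]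
    ring

theorem blochVec_eq_rot_mulVec (φ θ : ℝ) :
    blochVec 1 φ θ = rot 1 (Complex.exp (-Complex.I * φ)) θ *ᵥ blochVec 1 φ 0 := by
  have := eq_exp_smul_mulVec (hasDerivAt_meridian φ) θ
  rwa [meridian_ofReal, ← Complex.ofReal_zero, meridian_ofReal] at this

theorem norm_exp_I_mul_half (φ : ℝ) : ‖Complex.exp (Complex.I * φ / 2)‖ = 1 := by
  rw [show Complex.I * φ / 2 = ((φ / 2 : ℝ) : ℂ) * Complex.I by push_cast; ring]
  exact Complex.norm_exp_ofReal_mul_I _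

theorem blochVec_one_pole (φ : ℝ) :
    blochVec 1 φ 0 = Complex.exp (Complex.I * φ / 2) • blochVec 1 0 0 := by
  rw [← meridian_ofReal, ← meridian_ofReal]
  ext i
  fin_cases i <;> simp [meridian]

/-- At the pole the longitude only changes the phase of the vector. -/
theorem blochState_pole (N : ℕ) (φ : ℝ) : blochState N φ 0 = blochState N 0 0 := by
  rw [blochState_eq_cohState, blochState_eq_cohState, blochVec_one_pole,
    cohState_smul N (norm_exp_I_mul_half φ)]

theorem star_dotProduct_self (z : Fin 2 → ℂ) :
    star z ⬝ᵥ z = ((‖z 0‖ ^ 2 + ‖z 1‖ ^ 2 : ℝ) : ℂ) := by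
  simp [dotProduct, Fin.sum_univ_two, Complex.conj_mul']

theorem star_blochVec_dotProduct_self (φ θ : ℝ) :
    star (blochVec 1 φ θ) ⬝ᵥ blochVec 1 φ θ = 1 := by
  rw [blochVec_eq_rot_mulVec, star_rot_mulVec_dotProduct, blochVec_one_pole, star_dotProduct_self]
  have := norm_exp_I_mul_half φ
  rw [← meridian_ofReal]
  simp [meridian, this]

/-- This is where geometry enters: the transition probability of two spinors is `(1 + cos α) / 2`,
with `α` the angle between their points on the sphere. -/
theorem norm_sq_star_blochVec_dotProduct (φ θ φ' θ' : ℝ) :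
    ‖star (blochVec 1 φ' θ') ⬝ᵥ blochVec 1 φ θ‖ ^ 2
      = Real.cos (geodesicDist (φ, θ) (φ', θ') / 2) ^ 2 := by
  have hn (φ θ : ℝ) : ‖spherePoint φ θ‖ = 1 := by
    rw [EuclideanSpace.norm_eq, Real.sqrt_eq_one, Fin.sum_univ_three]
    simp only [spherePoint, Real.norm_eq_abs, sq_abs]
    simp
    nlinarith [Real.sin_sq_add_cos_sq φ, Real.sin_sq_add_cos_sq θ]
  have hcos : Real.cos (geodesicDist (φ, θ) (φ', θ'))
      = Real.sin θ * Real.sin θ' * Real.cos (φ - φ') + Real.cos θ * Real.cos θ' := by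
    rw [geodesicDist, InnerProductGeometry.cos_angle, hn, hn, PiLp.inner_apply,
      Fin.sum_univ_three, Real.cos_sub]
    simp [spherePoint]
    ring
  rw [Real.cos_sq, mul_div_cancel₀ _ two_ne_zero, hcos]
  have h1 : star (blochVec 1 φ' θ') ⬝ᵥ blochVec 1 φ θ =
      ((Real.cos (θ / 2) * Real.cos (θ' / 2) : ℝ) : ℂ)
        * (Complex.cos ((φ - φ') / 2) + Complex.sin ((φ - φ') / 2) * Complex.I)
      + ((Real.sin (θ / 2) * Real.sin (θ' / 2) : ℝ) : ℂ)
        * (Complex.cos ((φ - φ') / 2) - Complex.sin ((φ - φ') / 2) * Complex.I) := by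
    have e1 : Complex.cos ((φ - φ') / 2) + Complex.sin ((φ - φ') / 2) * Complex.I =
        Complex.exp (-Complex.I * φ' / 2) * Complex.exp (Complex.I * φ / 2) := by
      rw [← Complex.exp_mul_I, ← Complex.exp_add]
      congr 1
      ring
    have e2 : Complex.cos ((φ - φ') / 2) - Complex.sin ((φ - φ') / 2) * Complex.I =
        Complex.exp (Complex.I * φ' / 2) * Complex.exp (-Complex.I * φ / 2) := by
      rw [sub_eq_add_neg, ← neg_mul, ← Complex.sin_neg, ← Complex.cos_neg, ← Complex.exp_mul_I,
        ← Complex.exp_add]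
      congr 1
      ring
    rw [e1, e2, ← meridian_ofReal, ← meridian_ofReal]
    simp [meridian, dotProduct, Fin.sum_univ_two, ← Complex.exp_conj, ← Complex.cos_conj,
      ← Complex.sin_conj, map_ofNat]
    ring
  have h2 : Complex.cos ((φ - φ') / 2) = ((Real.cos ((φ - φ') / 2) : ℝ) : ℂ) := by push_cast; rfl
  have h3 : Complex.sin ((φ - φ') / 2) = ((Real.sin ((φ - φ') / 2) : ℝ) : ℂ) := by push_cast; rfl
  rw [h1, h2, h3, ← Complex.normSq_eq_norm_sq, Complex.normSq_apply]
  simp only [Complex.add_re, Complex.add_im, Complex.sub_re, Complex.sub_im, Complex.re_ofReal_mul,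
    Complex.im_ofReal_mul, Complex.ofReal_re, Complex.ofReal_im, Complex.I_re, Complex.I_im]
  have c1 : Real.cos (φ - φ') = 2 * Real.cos ((φ - φ') / 2) ^ 2 - 1 := by
    rw [← Real.cos_two_mul]; congr 1; ring
  have c2 (x : ℝ) : Real.cos x = 2 * Real.cos (x / 2) ^ 2 - 1 := by
    rw [← Real.cos_two_mul]; congr 1; ring
  have c3 (x : ℝ) : Real.sin x = 2 * Real.sin (x / 2) * Real.cos (x / 2) := by
    rw [← Real.sin_two_mul]; congr 1; ring
  have s1 (x : ℝ) := Real.sin_sq x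
  rw [c1, c2 θ, c2 θ', c3 θ, c3 θ']
  ring_nf
  simp only [s1]
  ring

theorem exists_eq_smul_blochVec {z : Fin 2 → ℂ} {α : ℝ} (h0 : ‖z 0‖ = Real.cos (α / 2))
    (h1 : ‖z 1‖ = Real.sin (α / 2)) : ∃ (c : ℂ) (φ : ℝ), ‖c‖ = 1 ∧ z = c • blochVec 1 φ α := by
  -- The mean of the two arguments is the global phase, their difference the longitude.
  refine ⟨Complex.exp (((((z 0).arg + (z 1).arg) / 2 : ℝ) : ℂ) * Complex.I),
    (z 0).arg - (z 1).arg, Complex.norm_exp_ofReal_mul_I _, ?_⟩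
  rw [← meridian_ofReal]
  ext i
  fin_cases i
  · simp only [meridian, Pi.smul_apply, smul_eq_mul, Fin.zero_eta, Matrix.cons_val_zero]
    rw [← mul_assoc, ← Complex.exp_add]
    conv_lhs => rw [← Complex.norm_mul_exp_arg_mul_I (z 0), h0, mul_comm]
    push_cast
    congr 2
    ring
  · simp only [meridian, Pi.smul_apply, smul_eq_mul, Fin.mk_one, Matrix.cons_val_one, Matrix.cons_val_fin_one]
    rw [← mul_assoc, ← Complex.exp_add]
    conv_lhs => rw [← Complex.norm_mul_exp_arg_mul_I (z 1), h1, mul_comm]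
    push_cast
    congr 2
    ring

/-- The rotation taking `q` to the pole preserves overlaps, so the image of `p` has polar angle
equal to the geodesic distance. Its longitude `φ` is not controlled; later bounds must therefore
hold for all `φ`. The rotation data depend neither on `N` nor on `a`. -/
theorem exists_rot_to_pole (p q : ℝ × ℝ) : ∃ (φ : ℝ) (u : ℂ) (t : ℝ), ∀ (N : ℕ) (a : Alg N),
    blochState N p.1 p.2 a = blochState N φ (geodesicDist p q) (rot N u (-t) * a * rot N u t) ∧
    blochState N q.1 q.2 a = blochState N 0 0 (rot N u (-t) * a * rot N u t) := by
  set u := Complex.exp (-Complex.I * q.1) with hu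
  set z := rot 1 u (-q.2) *ᵥ blochVec 1 p.1 p.2 with hz
  set α := geodesicDist p q with hα
  have hx : blochVec 1 p.1 p.2 = rot 1 u q.2 *ᵥ z := by
    rw [hz, Matrix.mulVec_mulVec, rot_mul_rot_neg, Matrix.one_mulVec]
  have hunit : ‖z 0‖ ^ 2 + ‖z 1‖ ^ 2 = 1 := by
    have := star_dotProduct_self z
    rw [hz, star_rot_mulVec_dotProduct, star_blochVec_dotProduct_self, ← hz] at this
    exact_mod_cast this.symm
  have hα0 : 0 ≤ α := InnerProductGeometry.angle_nonneg _ _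
  have hαπ : α ≤ Real.pi := InnerProductGeometry.angle_le_pi _ _
  have hz0 : ‖z 0‖ ^ 2 = Real.cos (α / 2) ^ 2 := by
    rw [hα, ← norm_sq_star_blochVec_dotProduct, hx, blochVec_eq_rot_mulVec q.1 q.2, ← hu,
      star_rot_mulVec_dotProduct]
    congr 1
    rw [← meridian_ofReal]
    simp [meridian, dotProduct, Fin.sum_univ_two, norm_exp_I_mul_half]
  have h0 : ‖z 0‖ = Real.cos (α / 2) := by
    rwa [sq_eq_sq₀ (norm_nonneg _) (Real.cos_nonneg_of_mem_Icc ⟨by linarith, by linarith⟩)] at hz0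
  have h1 : ‖z 1‖ = Real.sin (α / 2) := by
    rw [← sq_eq_sq₀ (norm_nonneg _)
      (Real.sin_nonneg_of_nonneg_of_le_pi (by linarith) (by linarith)), Real.sin_sq, ← hz0]
    linarith
  obtain ⟨c, φ, hc, hcz⟩ := exists_eq_smul_blochVec h0 h1
  refine ⟨φ, u, q.2, fun N a => ⟨?_, ?_⟩⟩
  · rw [blochState_eq_cohState, hx, cohState_rot_mulVec, hcz, cohState_smul N hc,
      blochState_eq_cohState]
  · rw [blochState_eq_cohState, blochVec_eq_rot_mulVec q.1 q.2, ← hu, cohState_rot_mulVec,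
      ← blochState_eq_cohState, blochState_pole]

/-! ### Bounding the commutator from below and from above -/

theorem norm_star_dotProduct_mulVec_le {n : Type*} [Fintype n] [DecidableEq n] (M : Matrix n n ℂ)
    (x : n → ℂ) : ‖star x ⬝ᵥ (M *ᵥ x)‖ ≤
      ‖Matrix.toEuclideanCLM (n := n) (𝕜 := ℂ) M‖ * ‖star x ⬝ᵥ x‖ := by
  have h (y : n → ℂ) : star x ⬝ᵥ y = inner ℂ (WithLp.toLp 2 x) (WithLp.toLp 2 y) := by
    rw [EuclideanSpace.inner_toLp_toLp, dotProduct_comm]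
  rw [h, h, ← Matrix.toEuclideanCLM_toLp, inner_self_eq_norm_sq_to_K]
  refine (norm_inner_le_norm _ _).trans ?_
  have := (Matrix.toEuclideanCLM (n := n) (𝕜 := ℂ) M).le_opNorm (WithLp.toLp 2 x)
  refine (mul_le_mul_of_nonneg_left this (norm_nonneg _)).trans_eq ?_
  simp
  ring

theorem star_kronecker_dotProduct {m n : Type*} [Fintype m] [Fintype n] (A : Matrix m m ℂ)
    (B : Matrix n n ℂ) (x : m → ℂ) (y : n → ℂ) :
    star (fun k : m × n => x k.1 * y k.2) ⬝ᵥ ((A ⊗ₖ B) *ᵥ fun k : m × n => x k.1 * y k.2)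
      = (star x ⬝ᵥ (A *ᵥ x)) * (star y ⬝ᵥ (B *ᵥ y)) := by
  have h : ((A ⊗ₖ B) *ᵥ fun k : m × n => x k.1 * y k.2)
      = fun k : m × n => (A *ᵥ x) k.1 * (B *ᵥ y) k.2 := by
    ext ⟨i, j⟩
    simp only [Matrix.mulVec, dotProduct, Finset.sum_mul_sum, Fintype.sum_prod_type,
      Matrix.kroneckerMap_apply]
    exact Finset.sum_congr rfl fun _ _ => Finset.sum_congr rfl fun _ _ => by ring
  rw [h]
  simp only [dotProduct, Finset.sum_mul_sum, Fintype.sum_prod_type, Pi.star_apply, star_mul']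
  exact Finset.sum_congr rfl fun _ _ => Finset.sum_congr rfl fun _ _ => by ring

theorem norm_star_dotProduct_commutator_rotGen_le {N : ℕ} (a : Alg N) {u : ℂ} (hu : ‖u‖ = 1)
    (v : Fin (N + 1) → ℂ) : ‖star v ⬝ᵥ ((rotGen N u * a - a * rotGen N u) *ᵥ v)‖
      ≤ lipNorm N a * ‖star v ⬝ᵥ v‖ := by
  have hE : opE 1 = !![0, 0; 1, 0] := by
    ext i j; fin_cases i <;> fin_cases j <;> simp [opE_apply]
  have hF : opF 1 = !![0, 1; 0, 0] := by
    ext i j; fin_cases i <;> fin_cases j <;> simp [opF_apply]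
  have hH : opH 1 = !![-1 / 2, 0; 0, 1 / 2] := by
    ext i j; fin_cases i <;> fin_cases j <;> simp [opH] <;> norm_num
  -- The expectations of `H`, `F`, `E` in `χ` are `0`, `iu`, `-iū`, so only `2i [X, a]` survives
  -- from `[D_N, a]`; its factor `2` cancels against `‖χ‖² = 2`.
  set χ : Fin (1 + 1) → ℂ := ![1, Complex.I * u] with hχ
  have huu : star u * u = 1 := by
    rw [Complex.star_def, Complex.conj_mul', hu]
    simp
  have hxE : star χ ⬝ᵥ (opE 1 *ᵥ χ) = -Complex.I * star u := by
    rw [hE]; simp [hχ, Matrix.mulVec, dotProduct, Fin.sum_univ_two, mul_comm]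
  have hxF : star χ ⬝ᵥ (opF 1 *ᵥ χ) = Complex.I * u := by
    rw [hF]; simp [hχ, Matrix.mulVec, dotProduct, Fin.sum_univ_two]
  have hI : Complex.I * Complex.I = -1 := Complex.I_mul_I
  have hxH : star χ ⬝ᵥ (opH 1 *ᵥ χ) = 0 := by
    rw [hH]
    simp [hχ, Matrix.mulVec, dotProduct, Fin.sum_univ_two]
    rw [Complex.star_def] at huu
    linear_combination (-1/2) * (starRingEnd ℂ) u * u * hI + (1/2) * huu
  have hx1 : star χ ⬝ᵥ χ = 2 := by
    simp [hχ, dotProduct, Fin.sum_univ_two]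
    rw [Complex.star_def] at huu
    linear_combination -(starRingEnd ℂ) u * u * hI + huu
  have hmain := norm_star_dotProduct_mulVec_le (diracComm N a) (fun k => v k.1 * χ k.2)
  have h1 : star (fun k : Fin (N + 1) × Fin (1 + 1) => v k.1 * χ k.2) ⬝ᵥ (fun k => v k.1 * χ k.2)
      = (star v ⬝ᵥ v) * 2 := by
    have := star_kronecker_dotProduct (1 : Alg N) (1 : Alg 1) v χ
    rwa [Matrix.one_kronecker_one, Matrix.one_mulVec, Matrix.one_mulVec, Matrix.one_mulVec,
      hx1] at this
  have h2 : star (fun k : Fin (N + 1) × Fin (1 + 1) => v k.1 * χ k.2) ⬝ᵥ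
      (diracComm N a *ᵥ (fun k => v k.1 * χ k.2))
      = 2 * Complex.I * (star v ⬝ᵥ ((rotGen N u * a - a * rotGen N u) *ᵥ v)) := by
    have hcomm : rotGen N u * a - a * rotGen N u = (u / 2) • (opE N * a - a * opE N)
        - (star u / 2) • (opF N * a - a * opF N) := by
      rw [rotGen]
      simp only [Matrix.smul_mul, Matrix.mul_smul, sub_mul, mul_sub]
      module
    rw [diracComm_eq, hcomm, Matrix.add_mulVec, Matrix.add_mulVec, Matrix.smul_mulVec,
      dotProduct_add, dotProduct_add, dotProduct_smul]
    rw [star_kronecker_dotProduct, star_kronecker_dotProduct, star_kronecker_dotProduct, hxE, hxF, hxH, Matrix.sub_mulVec _ ((star u / 2) • _), dotProduct_sub, Matrix.smul_mulVec,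
      Matrix.smul_mulVec, dotProduct_smul, dotProduct_smul]
    simp only [smul_eq_mul]
    ring
  change _ ≤ lipNorm N a * _ at hmain
  rw [h1, h2, norm_mul, norm_mul, norm_mul] at hmain
  simp only [Complex.norm_I, Complex.norm_ofNat, mul_one] at hmain
  linarith

/-- A diagonal `a` commutes with `H`, so `[D_N, a]` is block off-diagonal in the spinor index. Its
blocks `[E, a]` and `[F, a]` are weighted shifts, whose weights are bounded by the hypothesis. -/
theorem lipNorm_diagonal_le_one {N : ℕ} {d : ℕ → ℝ}
    (hd : ∀ m < N, |d (m + 1) - d m| * Real.sqrt (((N : ℝ) - m) * ((m : ℝ) + 1)) ≤ 1) :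
    lipNorm N (Matrix.diagonal fun i : Fin (N + 1) => (d i : ℂ)) ≤ 1 := by
  set a : Alg N := Matrix.diagonal fun i : Fin (N + 1) => (d i : ℂ) with ha
  have hE1 : opE 1 = !![0, 0; 1, 0] := by
    ext i j; fin_cases i <;> fin_cases j <;> simp [opE_apply]
  have hF1 : opF 1 = !![0, 1; 0, 0] := by
    ext i j; fin_cases i <;> fin_cases j <;> simp [opF_apply]
  have hH : opH N * a - a * opH N = 0 := by
    rw [ha, opH, Matrix.diagonal_mul_diagonal, Matrix.diagonal_mul_diagonal, sub_eq_zero]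
    congr 1
    ext i
    ring
  have hnorm (x r : ℝ) : |x| * Real.sqrt r = ‖((x * Real.sqrt r : ℝ) : ℂ)‖ := by
    rw [Complex.norm_real, norm_mul, Real.norm_eq_abs, Real.norm_of_nonneg (Real.sqrt_nonneg _)]
  have hE (v : Fin (N + 1) → ℂ) :
      ∑ i, ‖((opE N * a - a * opE N) *ᵥ v) i‖ ^ 2 ≤ ∑ i, ‖v i‖ ^ 2 := by
    -- Entry `m + 1` of the image is compared with entry `m` of `v`; entry `0` of the image vanishes
    -- and the last entry of `v` is discarded.
    rw [Fin.sum_univ_succ, Fin.sum_univ_castSucc (fun i => ‖v i‖ ^ 2), add_comm]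
    refine add_le_add (Finset.sum_le_sum fun m _ => ?_) ?_
    · rw [Matrix.sub_mulVec, ← Matrix.mulVec_mulVec, ← Matrix.mulVec_mulVec, Pi.sub_apply,
        opE_mulVec_succ, ha, Matrix.mulVec_diagonal, Matrix.mulVec_diagonal, opE_mulVec_succ]
      refine pow_le_pow_left₀ (norm_nonneg _) ?_ 2
      have := mul_le_of_le_one_left (norm_nonneg (v m.castSucc)) (hd m m.is_lt)
      refine le_trans (le_of_eq ?_) this
      rw [hnorm, ← norm_mul, ← norm_neg]
      congr 1
      simp only [Fin.val_succ, Fin.val_castSucc]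
      push_cast
      ring
    · rw [Matrix.sub_mulVec, ← Matrix.mulVec_mulVec, ← Matrix.mulVec_mulVec, Pi.sub_apply,
        opE_mulVec_zero, ha, Matrix.mulVec_diagonal, opE_mulVec_zero]
      simp
  have hF (v : Fin (N + 1) → ℂ) :
      ∑ i, ‖((opF N * a - a * opF N) *ᵥ v) i‖ ^ 2 ≤ ∑ i, ‖v i‖ ^ 2 := by
    rw [Fin.sum_univ_castSucc, Fin.sum_univ_succ (fun i => ‖v i‖ ^ 2), add_comm (‖v 0‖ ^ 2)]
    refine add_le_add (Finset.sum_le_sum fun m _ => ?_) ?_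
    · rw [Matrix.sub_mulVec, ← Matrix.mulVec_mulVec, ← Matrix.mulVec_mulVec, Pi.sub_apply,
        opF_mulVec_castSucc, ha, Matrix.mulVec_diagonal, Matrix.mulVec_diagonal,
        opF_mulVec_castSucc]
      refine pow_le_pow_left₀ (norm_nonneg _) ?_ 2
      have := mul_le_of_le_one_left (norm_nonneg (v m.succ)) (hd m m.is_lt)
      refine le_trans (le_of_eq ?_) this
      rw [hnorm, ← norm_mul]
      congr 1
      simp only [Fin.val_succ, Fin.val_castSucc]
      push_cast
      ring
    · rw [Matrix.sub_mulVec, ← Matrix.mulVec_mulVec, ← Matrix.mulVec_mulVec, Pi.sub_apply,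
        opF_mulVec_last, ha, Matrix.mulVec_diagonal, opF_mulVec_last]
      simp
  refine ContinuousLinearMap.opNorm_le_bound _ zero_le_one fun x => ?_
  rw [one_mul, ← sq_le_sq₀ (norm_nonneg _) (norm_nonneg _), EuclideanSpace.norm_sq_eq,
    EuclideanSpace.norm_sq_eq, Fintype.sum_prod_type, Fintype.sum_prod_type]
  have h0 (k : Fin (N + 1)) : (diracComm N a *ᵥ x.ofLp) (k, 0)
      = ((opE N * a - a * opE N) *ᵥ fun i => x (i, 1)) k := by
    rw [diracComm_eq, hH]
    simp [Matrix.mulVec, dotProduct, Fintype.sum_prod_type, hE1, hF1, Fin.sum_univ_two]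
  have h1 (k : Fin (N + 1)) : (diracComm N a *ᵥ x.ofLp) (k, 1)
      = ((opF N * a - a * opF N) *ᵥ fun i => x (i, 0)) k := by
    rw [diracComm_eq, hH]
    simp [Matrix.mulVec, dotProduct, Fintype.sum_prod_type, hE1, hF1, Fin.sum_univ_two]
  simp only [Fin.sum_univ_two, Finset.sum_add_distrib, Matrix.ofLp_toEuclideanCLM]
  rw [add_comm (∑ i, ‖x (i, 0)‖ ^ 2)]
  refine add_le_add ?_ ?_
  · simp only [h0]
    exact hE _
  · simp only [h1]
    exact hF _

/-! ### The test matrix and Bernstein approximation -/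

theorem blochState_diagonal (N : ℕ) (φ θ : ℝ) (d : ℕ → ℝ) :
    blochState N φ θ (Matrix.diagonal fun i : Fin (N + 1) => (d i : ℂ)) =
      ((∑ i : Fin (N + 1), (N.choose i : ℝ) * (Real.sin (θ / 2) ^ 2) ^ i.val
        * (1 - Real.sin (θ / 2) ^ 2) ^ (N - i.val) * d i : ℝ) : ℂ) := by
  rw [blochState, dotProduct, Complex.ofReal_sum]
  refine Finset.sum_congr rfl fun i _ => ?_
  rw [Matrix.mulVec_diagonal, Pi.star_apply, mul_left_comm, Complex.star_def, Complex.conj_mul']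
  have he : ‖Complex.exp (-Complex.I * ((i.val : ℂ) - (N : ℂ) / 2) * (φ : ℂ))‖ = 1 := by
    rw [show -Complex.I * ((i.val : ℂ) - (N : ℂ) / 2) * (φ : ℂ)
      = ((-(i.val - N / 2) * φ : ℝ) : ℂ) * Complex.I by push_cast; ring]
    exact Complex.norm_exp_ofReal_mul_I _
  rw [blochVec, norm_mul, norm_mul, he, mul_one, Complex.norm_real, Complex.norm_real,
    ← Complex.ofReal_pow, ← Complex.ofReal_mul]
  congr 1
  rw [mul_pow, Real.norm_eq_abs, sq_abs, Real.norm_eq_abs, sq_abs, Real.sq_sqrt (Nat.cast_nonneg _),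
    ← Real.cos_sq', mul_pow]
  ring

/-- The function of the height whose value at the point of polar angle `θ` is `θ`. -/
def polarAngle : C(unitInterval, ℝ) where
  toFun s := Real.arccos (1 - 2 * s)
  continuous_toFun := by fun_prop

/-- The derivative of `arccos (1 - 2x/(N+2))` is `1/√(x(N+2-x))`, and `x(N+2-x) ≥ (N-m)(m+1)` on
`[m+1, m+2]`. The shifted nodes stay away from the endpoints, where the derivative blows up; with
nodes `i/N` the first increment would already be too large, the product tending to `2`. -/
theorem arccos_increment_mul_le {N m : ℕ} (h : m < N) :
    |Real.arccos (1 - 2 * (((m + 1 : ℕ) + 1) / (N + 2))) - Real.arccos (1 - 2 * ((m + 1) / (N + 2)))|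
      * Real.sqrt (((N : ℝ) - m) * ((m : ℝ) + 1)) ≤ 1 := by
  have hmN : (m : ℝ) + 1 ≤ N := by exact_mod_cast h
  have hm : (0 : ℝ) ≤ m := Nat.cast_nonneg m
  have hw : 0 < ((N : ℝ) - m) * ((m : ℝ) + 1) := mul_pos (by linarith) (by linarith)
  have hM : (0 : ℝ) < N + 2 := by positivity
  have hderiv : ∀ x ∈ Set.Icc ((m : ℝ) + 1) (m + 1 + 1), HasDerivWithinAt
      (fun x : ℝ => Real.arccos (1 - 2 * (x / (N + 2)))) (1 / Real.sqrt (x * (N + 2 - x)))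
      (Set.Icc ((m : ℝ) + 1) (m + 1 + 1)) x := by
    intro x hx
    have hx0 : 0 < x := by linarith [hx.1]
    have hx1 : 0 < (N : ℝ) + 2 - x := by linarith [hx.2]
    have hlt : x / (N + 2) < 1 := by rw [div_lt_one hM]; linarith
    have hpos : 0 < x / (N + 2) := by positivity
    have hin : HasDerivAt (fun x : ℝ => 1 - 2 * (x / (N + 2))) (-(2 * (1 / (N + 2)))) x :=
      (((hasDerivAt_id x).div_const _).const_mul 2).const_sub 1
    have := (Real.hasDerivAt_arccos (x := 1 - 2 * (x / (N + 2))) (by linarith) (by linarith)).comp x hin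
    refine (this.congr_deriv ?_).hasDerivWithinAt
    have hsq : 1 - (1 - 2 * (x / (N + 2))) ^ 2 = (2 / (N + 2)) ^ 2 * (x * (N + 2 - x)) := by
      field_simp
      ring
    rw [hsq, Real.sqrt_mul (by positivity), Real.sqrt_sq (by positivity)]
    have : Real.sqrt (x * (N + 2 - x)) ≠ 0 := (Real.sqrt_pos.2 (by positivity)).ne'
    field_simp
  have hbound : ∀ x ∈ Set.Icc ((m : ℝ) + 1) (m + 1 + 1), ‖1 / Real.sqrt (x * (N + 2 - x))‖
      ≤ 1 / Real.sqrt (((N : ℝ) - m) * ((m : ℝ) + 1)) := by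
    intro x hx
    rw [Real.norm_of_nonneg (by positivity)]
    refine one_div_le_one_div_of_le (Real.sqrt_pos.2 hw) (Real.sqrt_le_sqrt ?_)
    obtain ⟨h1, h2⟩ := hx
    nlinarith [mul_nonneg (sub_nonneg.2 h1) (sub_nonneg.2 h2),
      mul_nonneg (sub_nonneg.2 h1) (sub_nonneg.2 hmN), mul_nonneg hm (sub_nonneg.2 h2)]
  have := (convex_Icc _ _).norm_image_sub_le_of_norm_hasDerivWithin_le hderiv hbound
    (Set.left_mem_Icc.2 (by linarith)) (Set.right_mem_Icc.2 (by linarith))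
  rw [add_sub_cancel_left, norm_one, mul_one, le_div_iff₀ (Real.sqrt_pos.2 hw), Real.norm_eq_abs] at this
  push_cast
  exact this

theorem eventually_abs_polarAngle_shift_le {ε : ℝ} (hε : 0 < ε) : ∀ᶠ N : ℕ in atTop,
    ∀ i : Fin (N + 1),
      |Real.arccos (1 - 2 * ((i.val + 1) / (N + 2))) - polarAngle (bernstein.z i)| ≤ ε := by
  have huc := CompactSpace.uniformContinuous_of_continuous polarAngle.continuous
  obtain ⟨δ, hδ, hf⟩ := Metric.uniformContinuous_iff.1 huc ε hε
  have hlim := tendsto_one_div_add_atTop_nhds_zero_nat (𝕜 := ℝ)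
  filter_upwards [hlim.eventually_lt_const hδ, eventually_ge_atTop 1] with N hN hN1 i
  have hN1' : (1 : ℝ) ≤ N := by exact_mod_cast hN1
  have hi : (i.val : ℝ) ≤ N := by exact_mod_cast Nat.lt_succ_iff.1 i.is_lt
  have hi0 : (0 : ℝ) ≤ i.val := Nat.cast_nonneg _
  have hmem : ((i.val : ℝ) + 1) / (N + 2) ∈ unitInterval :=
    ⟨by positivity, by rw [div_le_one (by positivity)]; linarith⟩
  have hd : dist (⟨((i.val : ℝ) + 1) / (N + 2), hmem⟩ : unitInterval) (bernstein.z i) < δ := by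
    refine lt_of_le_of_lt ?_ hN
    rw [Subtype.dist_eq, Real.dist_eq]
    change |((i.val : ℝ) + 1) / (N + 2) - (i.val : ℝ) / N| ≤ _
    -- Since `|N - 2i| ≤ N`, the shift moves each node by at most `1/(N+2)`.
    have : ((i.val : ℝ) + 1) / (N + 2) - (i.val : ℝ) / N = ((N - 2 * i.val) / N) / (N + 2) := by
      field_simp
      ring
    rw [this, abs_div, abs_of_pos (by positivity : (0 : ℝ) < N + 2)]
    refine div_le_div₀ zero_le_one ?_ (by positivity) (by linarith)
    rw [abs_div, abs_of_pos (by linarith : (0 : ℝ) < N), div_le_one (by linarith), abs_le]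
    constructor <;> linarith
  have := hf hd
  rw [Real.dist_eq] at this
  exact this.le

theorem sum_bernstein (N : ℕ) (s : ℝ) :
    ∑ i : Fin (N + 1), (N.choose i : ℝ) * s ^ i.val * (1 - s) ^ (N - i.val) = 1 := by
  have := add_pow s (1 - s) N
  rw [add_sub_cancel, one_pow, Finset.sum_range] at this
  refine Eq.trans ?_ this.symm
  exact Finset.sum_congr rfl fun i _ => by ring

theorem eventually_exists_test_matrix {ε : ℝ} (hε : 0 < ε) : ∀ᶠ N : ℕ in atTop,
    ∃ a : Alg N, a.IsDiag ∧ a.IsHermitian ∧ lipNorm N a ≤ 1 ∧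
      ∀ θ ∈ Set.Icc (0 : ℝ) Real.pi, ∀ φ : ℝ,
        θ - ε ≤ ‖blochState N φ θ a - blochState N 0 0 a‖ := by
  -- One `ε/4` pays for Bernstein approximation and one for the node shift; the total `ε/2` is paid
  -- twice, at `θ` and at the pole.
  have hb := Metric.tendsto_nhds.1 (bernsteinApproximation_uniform polarAngle) (ε / 4) (by linarith)
  filter_upwards [hb, eventually_abs_polarAngle_shift_le (by linarith : 0 < ε / 4)] with N hN hs
  set d : ℕ → ℝ := fun i => Real.arccos (1 - 2 * (((i : ℝ) + 1) / (N + 2))) with hd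
  refine ⟨Matrix.diagonal fun i : Fin (N + 1) => (d i : ℂ), Matrix.isDiag_diagonal _, ?_,
    lipNorm_diagonal_le_one fun m hm => arccos_increment_mul_le hm, fun θ hθ φ => ?_⟩
  · refine Matrix.isHermitian_diagonal_of_self_adjoint _ ?_
    ext i
    simp
  have key : ∀ t ∈ Set.Icc (0 : ℝ) Real.pi,
      |∑ i : Fin (N + 1), (N.choose i : ℝ) * (Real.sin (t / 2) ^ 2) ^ i.val
        * (1 - Real.sin (t / 2) ^ 2) ^ (N - i.val) * d i - t| ≤ ε / 2 := by
    intro t ht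
    set s := Real.sin (t / 2) ^ 2 with hsdef
    have hs0 : 0 ≤ s := sq_nonneg _
    have hs1 : s ≤ 1 := Real.sin_sq_le_one _
    have hval : polarAngle ⟨s, hs0, hs1⟩ = t := by
      change Real.arccos (1 - 2 * s) = t
      have : 1 - 2 * s = Real.cos t := by
        rw [← mul_div_cancel₀ t two_ne_zero, Real.cos_two_mul, Real.cos_sq']
        ring
      rw [this, Real.arccos_cos ht.1 ht.2]
    have h1 : |bernsteinApproximation N polarAngle ⟨s, hs0, hs1⟩ - t| ≤ ε / 4 := by
      have := (ContinuousMap.dist_apply_le_dist (f := bernsteinApproximation N polarAngle)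
        (g := polarAngle) ⟨s, hs0, hs1⟩).trans hN.le
      rwa [Real.dist_eq, hval] at this
    have h2 : |∑ i : Fin (N + 1), (N.choose i : ℝ) * s ^ i.val * (1 - s) ^ (N - i.val) * d i
        - bernsteinApproximation N polarAngle ⟨s, hs0, hs1⟩| ≤ ε / 4 := by
      rw [bernsteinApproximation.apply, ← Finset.sum_sub_distrib]
      refine (Finset.abs_sum_le_sum_abs _ _).trans ?_
      calc _ ≤ ∑ i : Fin (N + 1), (N.choose i : ℝ) * s ^ i.val * (1 - s) ^ (N - i.val) * (ε / 4) := by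
            refine Finset.sum_le_sum fun i _ => ?_
            rw [bernstein_apply, smul_eq_mul, ← mul_sub, abs_mul]
            have h0 : 0 ≤ (N.choose i : ℝ) * s ^ i.val * (1 - s) ^ (N - i.val) :=
              mul_nonneg (by positivity) (pow_nonneg (by linarith) _)
            rw [abs_of_nonneg h0]
            exact mul_le_mul_of_nonneg_left (hs i) h0
        _ = ε / 4 := by rw [← Finset.sum_mul, sum_bernstein, one_mul]
    rw [abs_le] at h1 h2 ⊢
    constructor <;> linarith [h1.1, h1.2, h2.1, h2.2]
  rw [blochState_diagonal, blochState_diagonal, ← Complex.ofReal_sub, Complex.norm_real,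
    Real.norm_eq_abs]
  refine le_trans ?_ (le_abs_self _)
  have h1 := abs_le.1 (key θ hθ)
  have h2 := abs_le.1 (key 0 ⟨le_rfl, Real.pi_pos.le⟩)
  linarith [h1.1, h2.2]

/-! ### Comparing the distances with the angle -/

theorem hasDerivAt_cohState_meridian (N : ℕ) (φ : ℝ) (a : Alg N) (t : ℝ) :
    HasDerivAt (fun s : ℝ => cohState N (meridian φ s) a)
      (-(star (cohVec N (meridian φ t)) ⬝ᵥ ((rotGen N (Complex.exp (-Complex.I * φ)) * a
        - a * rotGen N (Complex.exp (-Complex.I * φ))) *ᵥ cohVec N (meridian φ t)))) t := by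
  set u := Complex.exp (-Complex.I * φ)
  set v := cohVec N (meridian φ t) with hv
  have h := hasDerivAt_cohVec (hasDerivAt_meridian φ (t : ℂ)) N
  rw [hasDerivAt_pi] at h
  -- Conjugation is not holomorphic, so the parameter is restricted to the real line before
  -- differentiating the sesquilinear form.
  have h' := fun i => (h i).comp_ofReal
  have h2 : ∀ i, HasDerivAt (fun s : ℝ => (a *ᵥ cohVec N (meridian φ s)) i)
      ((a *ᵥ (rotGen N u *ᵥ v)) i) t := fun i =>
    HasDerivAt.fun_sum (u := Finset.univ) fun j _ => (h' j).const_mul (a i j)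
  have h3 := HasDerivAt.fun_sum (u := Finset.univ) fun i _ => (h' i).star.mul (h2 i)
  refine h3.congr_deriv ?_
  have h4 : star (rotGen N u *ᵥ v) ⬝ᵥ (a *ᵥ v) = -(star v ⬝ᵥ ((rotGen N u * a) *ᵥ v)) := by
    rw [star_mulVec_dotProduct_mulVec, rotGen_conjTranspose, neg_mul, Matrix.neg_mulVec,
      dotProduct_neg]
  rw [Finset.sum_add_distrib, Matrix.sub_mulVec, dotProduct_sub, neg_sub, sub_eq_add_neg, ← h4,
    add_comm, ← Matrix.mulVec_mulVec]
  rfl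

theorem norm_blochState_sub_pole_le (N : ℕ) (φ : ℝ) {θ : ℝ} (hθ : 0 ≤ θ) (a : Alg N) :
    ‖blochState N φ θ a - blochState N 0 0 a‖ ≤ lipNorm N a * θ := by
  have hu : ‖Complex.exp (-Complex.I * φ)‖ = 1 := by
    rw [show -Complex.I * (φ : ℂ) = ((-φ : ℝ) : ℂ) * Complex.I by push_cast; ring]
    exact Complex.norm_exp_ofReal_mul_I _
  have hb (t : ℝ) : ‖-(star (cohVec N (meridian φ t)) ⬝ᵥ ((rotGen N (Complex.exp (-Complex.I * φ)) * a
        - a * rotGen N (Complex.exp (-Complex.I * φ))) *ᵥ cohVec N (meridian φ t)))‖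
      ≤ lipNorm N a := by
    have := norm_star_dotProduct_commutator_rotGen_le a hu (cohVec N (meridian φ t))
    rwa [star_cohVec_dotProduct, meridian_ofReal, star_blochVec_dotProduct_self, one_pow, norm_one,
      mul_one, ← meridian_ofReal, ← norm_neg] at this
  have := convex_univ.norm_image_sub_le_of_norm_hasDerivWithin_le
    (fun t _ => (hasDerivAt_cohState_meridian N φ a t).hasDerivWithinAt) (fun t _ => hb t)
    (mem_univ (0 : ℝ)) (mem_univ θ)
  rwa [meridian_ofReal, meridian_ofReal, ← blochState_eq_cohState, ← blochState_eq_cohState,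
    blochState_pole, sub_zero, Real.norm_of_nonneg hθ] at this

theorem norm_blochState_sub_le (N : ℕ) (p q : ℝ × ℝ) (a : Alg N) :
    ‖blochState N p.1 p.2 a - blochState N q.1 q.2 a‖ ≤ lipNorm N a * geodesicDist p q := by
  obtain ⟨φ, u, t, h⟩ := exists_rot_to_pole p q
  have hα : 0 ≤ geodesicDist p q := InnerProductGeometry.angle_nonneg _ _
  have hl := lipNorm_rot_conj_le N u (-t) a
  rw [neg_neg] at hl
  rw [(h N a).1, (h N a).2]
  exact (norm_blochState_sub_pole_le N φ hα _).trans (mul_le_mul_of_nonneg_right hl hα)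

theorem spectralDist_le (N : ℕ) (p q : ℝ × ℝ) :
    spectralDist N (blochState N p.1 p.2) (blochState N q.1 q.2)
      ≤ ENNReal.ofReal (geodesicDist p q) := by
  refine iSup₂_le fun a ha => ENNReal.ofReal_le_ofReal ?_
  exact (norm_blochState_sub_le N p q a).trans
    (mul_le_of_le_one_left (InnerProductGeometry.angle_nonneg _ _) ha.2)

theorem auxDist_le (N : ℕ) {θ : ℝ} (hθ : 0 ≤ θ) : auxDist N θ ≤ ENNReal.ofReal θ := by
  refine iSup₂_le fun a ha => ENNReal.ofReal_le_ofReal ?_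
  exact (norm_blochState_sub_pole_le N 0 hθ a).trans (mul_le_of_le_one_left hθ ha.2.2)

theorem isHermitian_rot_conj {N : ℕ} {a : Alg N} (ha : a.IsHermitian) (u : ℂ) (t : ℝ) :
    (rot N u t * a * rot N u (-t)).IsHermitian := by
  rw [← rot_conjTranspose]
  exact Matrix.isHermitian_mul_mul_conjTranspose _ ha

/-- The witness is `a` rotated back by the motion of `exists_rot_to_pole`, which remains admissible.
-/
theorem le_spectralDist {N : ℕ} {a : Alg N} (ha : a.IsHermitian) (hl : lipNorm N a ≤ 1) {r : ℝ}
    (p q : ℝ × ℝ)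
    (h : ∀ φ, r ≤ ‖blochState N φ (geodesicDist p q) a - blochState N 0 0 a‖) :
    ENNReal.ofReal r ≤ spectralDist N (blochState N p.1 p.2) (blochState N q.1 q.2) := by
  obtain ⟨φ, u, t, hr⟩ := exists_rot_to_pole p q
  refine le_trans ?_ (le_iSup₂ (rot N u t * a * rot N u (-t))
    ⟨isHermitian_rot_conj ha u t, (lipNorm_rot_conj_le N u t a).trans hl⟩)
  refine ENNReal.ofReal_le_ofReal ?_
  have hc : rot N u (-t) * (rot N u t * a * rot N u (-t)) * rot N u t = a := by
    simp only [mul_assoc, rot_neg_mul_rot, mul_one]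
    rw [← mul_assoc, rot_neg_mul_rot, one_mul]
  rw [(hr N _).1, (hr N _).2, hc]
  exact h φ

end FuzzySphere

end

theorem mainTheorem1 :
    ((∀ N : ℕ, 1 ≤ N → ∀ θ ∈ Set.Icc (0 : ℝ) Real.pi, FuzzySphere.auxDist N θ < ⊤) ∧
      TendstoUniformlyOn (fun (N : ℕ) (θ : ℝ) => (FuzzySphere.auxDist N θ).toReal)
        (fun θ : ℝ => θ) Filter.atTop (Set.Icc 0 Real.pi)) ∧
    ((∀ N : ℕ, 1 ≤ N → ∀ p ∈ FuzzySphere.sphereCoords, ∀ q ∈ FuzzySphere.sphereCoords,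
        FuzzySphere.spectralDist N (FuzzySphere.blochState N p.1 p.2)
          (FuzzySphere.blochState N q.1 q.2) < ⊤) ∧
      TendstoUniformlyOn
        (fun (N : ℕ) (x : (ℝ × ℝ) × (ℝ × ℝ)) =>
          (FuzzySphere.spectralDist N (FuzzySphere.blochState N x.1.1 x.1.2)
            (FuzzySphere.blochState N x.2.1 x.2.2)).toReal)
        (fun x : (ℝ × ℝ) × (ℝ × ℝ) => FuzzySphere.geodesicDist x.1 x.2)
        Filter.atTop (FuzzySphere.sphereCoords ×ˢ FuzzySphere.sphereCoords)) := by
  -- The upper bound has no error term; the lower one loses only `ε/2`, which makes the final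
  -- inequality strict.
  have key {d : ℝ≥0∞} {α ε : ℝ} (hα : 0 ≤ α) (hε : 0 < ε) (h1 : d ≤ ENNReal.ofReal α)
      (h2 : ENNReal.ofReal (α - ε / 2) ≤ d) : dist α d.toReal < ε := by
    have hd : d ≠ ⊤ := (h1.trans_lt ENNReal.ofReal_lt_top).ne
    have h1' := ENNReal.toReal_le_of_le_ofReal hα h1
    have h2' := (ENNReal.ofReal_le_iff_le_toReal hd).1 h2
    rw [Real.dist_eq, abs_lt]
    constructor <;> linarith
  refine ⟨⟨fun N _ θ hθ => (FuzzySphere.auxDist_le N hθ.1).trans_lt ENNReal.ofReal_lt_top, ?_⟩,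
    fun N _ p _ q _ => (FuzzySphere.spectralDist_le N p q).trans_lt ENNReal.ofReal_lt_top, ?_⟩
  · rw [Metric.tendstoUniformlyOn_iff]
    intro ε hε
    filter_upwards [FuzzySphere.eventually_exists_test_matrix (half_pos hε)] with N ⟨a, hd, hh, hl, ha⟩ θ hθ
    refine key hθ.1 hε (FuzzySphere.auxDist_le N hθ.1) (le_trans ?_ (le_iSup₂ a ⟨hd, hh, hl⟩))
    exact ENNReal.ofReal_le_ofReal (ha θ hθ 0)
  · rw [Metric.tendstoUniformlyOn_iff]
    intro ε hε
    filter_upwards [FuzzySphere.eventually_exists_test_matrix (half_pos hε)] with N ⟨a, _, hh, hl, ha⟩ x _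
    exact key (InnerProductGeometry.angle_nonneg _ _) hε (FuzzySphere.spectralDist_le N x.1 x.2)
      (FuzzySphere.le_spectralDist hh hl x.1 x.2
        (ha _ ⟨InnerProductGeometry.angle_nonneg _ _, InnerProductGeometry.angle_le_pi _ _⟩))
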